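/- Let $M$ be a smooth (Hausdorff) manifold of dimension $n$, let $A^k(M)=\Gamma(\wedge^kTM)$ be the space of smooth $k$-vector fields ($A^0(M)=C^\infty(M)$, $A^{-1}(M)=0$), let $\mathcal A(M)=\bigoplus_k A^k(M)$, and let $[\cdot,\cdot]:A^k(M)\times A^l(M)\to A^{k+l-1}(M)$ be the Schouten–Nijenhuis bracket, normalised so that $[V,Q]=L_VQ$ for $V\in A^1(M)$, $[P,Q]=-(-1)^{(p-1)(q-1)}[Q,P]$ and $[P,Q\wedge R]=[P,Q]\wedge R+(-1)^{(p-1)q}Q\wedge[P,R]$ for $P\in A^p(M)$, $Q\in A^q(M)$, $R\in\mathcal A(M)$. A higher connection on $M$ is a map $\nabla:\mathcal A(M)\times\mathcal A(M)\to\mathcal A(M)$ such that: $\nabla_XY\in A^{k+l-1}(M)$ for $X\in A^k(M)$, $Y\in A^l(M)$; $\nabla_{fX+X'}Y=f\nabla_XY+\nabla_{X'}Y$ and $\nabla_X(Y+Y')=\nabla_XY+\nabla_XY'$ for $f\in C^\infty(M)$ and $X,X',Y,Y'\in\mathcal A(M)$; $\nabla_Xf=[X,f]$ and $\nabla_X(fY)=[X,f]\wedge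 Y+f\nabla_XY$ for $X\in A^k(M)$, $f\in C^\infty(M)$, $Y\in\mathcal A(M)$; and $\nabla_fX=0$ for $f\in C^\infty(M)$, $X\in\mathcal A(M)$. Its higher torsion is $$T(X,Y)=\nabla_XY-(-1)^{(k-1)(l-1)}\nabla_YX-[X,Y]\qquad (X\in A^k(M),\ Y\in A^l(M)),$$ and $\nabla$ is torsion-free if $T\equiv0$. The restriction of $\nabla$ to $A^1(M)\times A^1(M)$ is an affine connection $\widetilde\nabla$ on $TM$. Extend it to $\mathcal A(M)\times\mathcal A(M)$ by letting $\widetilde\nabla_V$, for a vector field $V$, act on $\mathcal A(M)$ as a derivation of the wedge product with $\widetilde\nabla_Vf=Vf$, by setting $$\widetilde\nabla_{X_1\wedge\cdots\wedge X_k}Y=\sum_{j=1}^k(-1)^{k-j}X_1\wedge\cdots\wedge\widehat{X_j}\wedge\cdots\wedge X_k\wedge\widetilde\nabla_{X_j}Y$$ for vector fields $X_1,\dots,X_k$ ($k\ge1$), extended $C^\infty(M)$-linearly, and by setting $\widetilde\nabla_f=0$ for functions $f$. The twist fields of $\nabla$ are $F^{k,l}(X,Y)=\nabla_XY-\widetilde\nabla_XY$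 for $X\in A^k(M)$, $Y\in A^l(M)$. Theorem. A higher connection $\nabla$ is torsion-free if and only if (i) the affine connection $\widetilde\nabla$ is torsion-free, i.e. $\widetilde\nabla_VW-\widetilde\nabla_WV=[V,W]$ for all vector fields $V,W$; and (ii) $F^{k,l}(X,Y)=(-1)^{(k-1)(l-1)}F^{l,k}(Y,X)$ for all $k,l\ge0$, $X\in A^k(M)$, $Y\in A^l(M)$. -/

import Mathlib

open Bundle Manifold
open scoped ContDiff Topology

noncomputable section

namespace HigherConn

/-! ### Linear algebra in the model space `ℝⁿ` -/

/-- The standard basis `e₀, …, eₙ₋₁` of `ℝⁿ`. -/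
def stdBasis (n : ℕ) : Module.Basis (Fin n) ℝ (EuclideanSpace ℝ (Fin n)) :=
  (EuclideanSpace.basisFun (Fin n) ℝ).toBasis

/-- The dual basis `dxⁱ`. -/
def dx {n : ℕ} (i : Fin n) : Module.Dual ℝ (EuclideanSpace ℝ (Fin n)) :=
  (stdBasis n).coord i

/-- The basis of `⋀ ℝⁿ` consisting of the wedge products of standard basis vectors. -/
def wedgeBasis (n : ℕ) :
    Module.Basis (Finset (Fin n)) ℝ (ExteriorAlgebra ℝ (EuclideanSpace ℝ (Fin n))) :=
  (stdBasis n).ExteriorAlgebra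

/-- The interior product `α ⌋ x` from the left:
`α ⌋ (v₁ ∧ ⋯ ∧ vₖ) = ∑ⱼ (-1)^(j-1) α(vⱼ) v₁ ∧ ⋯ v̂ⱼ ⋯ ∧ vₖ`. -/
def contrL {n : ℕ} (α : Module.Dual ℝ (EuclideanSpace ℝ (Fin n)))
    (x : ExteriorAlgebra ℝ (EuclideanSpace ℝ (Fin n))) :
    ExteriorAlgebra ℝ (EuclideanSpace ℝ (Fin n)) :=
  CliffordAlgebra.contractLeft α x

/-- The interior product `x ⌊ α` from the right:
`(v₁ ∧ ⋯ ∧ vₖ) ⌊ α = ∑ⱼ (-1)^(k-j) α(vⱼ) v₁ ∧ ⋯ v̂ⱼ ⋯ ∧ vₖ`;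
on `k`-vectors it equals `(-1)^(k-1) α ⌋ x`. -/
def contrR {n : ℕ} (x : ExteriorAlgebra ℝ (EuclideanSpace ℝ (Fin n)))
    (α : Module.Dual ℝ (EuclideanSpace ℝ (Fin n))) :
    ExteriorAlgebra ℝ (EuclideanSpace ℝ (Fin n)) :=
  CliffordAlgebra.contractRight x α

/-- The partial derivative `∂ᵢ f (u)` of a function `f : ℝⁿ → ⋀ ℝⁿ`, taken componentwise. -/
def pderiv {n : ℕ} (i : Fin n)
    (f : EuclideanSpace ℝ (Fin n) → ExteriorAlgebra ℝ (EuclideanSpace ℝ (Fin n)))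
    (u : EuclideanSpace ℝ (Fin n)) : ExteriorAlgebra ℝ (EuclideanSpace ℝ (Fin n)) :=
  ∑ J : Finset (Fin n),
    (fderiv ℝ (fun w => (wedgeBasis n).repr (f w) J) u (stdBasis n i)) • wedgeBasis n J

/-! ### Multivector fields -/

section Fields

variable (n : ℕ) (M : Type*) [TopologicalSpace M] [ChartedSpace (EuclideanSpace ℝ (Fin n)) M]
  [IsManifold (𝓡 n) ∞ M]

/-- Smooth real functions on `M`. -/
abbrev Fn := C^∞⟮𝓡 n, M; 𝓘(ℝ, ℝ), ℝ⟯

/-- Smooth vector fields on `M`, i.e. smooth sections of `TM`. -/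
abbrev VF := Cₛ^∞⟮𝓡 n; EuclideanSpace ℝ (Fin n), fun p : M => TangentSpace (𝓡 n) p⟯

variable {n M}

/-- The trivialisation of `TM` over the preferred chart at `p`, at the point `q`:
the differential of that chart, `T_q M → ℝⁿ`. -/
def triv (p q : M) : TangentSpace (𝓡 n) q →ₗ[ℝ] EuclideanSpace ℝ (Fin n) :=
  ((trivializationAt (EuclideanSpace ℝ (Fin n)) (TangentSpace (𝓡 n)) p).continuousLinearMapAt ℝ q :
    TangentSpace (𝓡 n) q →L[ℝ] EuclideanSpace ℝ (Fin n))

/-- The inverse `ℝⁿ → T_q M` of `triv p q` (for `q` in the domain of the chart at `p`). -/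
def trivSymm (p q : M) : EuclideanSpace ℝ (Fin n) →ₗ[ℝ] TangentSpace (𝓡 n) q :=
  ((trivializationAt (EuclideanSpace ℝ (Fin n)) (TangentSpace (𝓡 n)) p).symmL ℝ q :
    EuclideanSpace ℝ (Fin n) →L[ℝ] TangentSpace (𝓡 n) q)

/-- A not necessarily continuous section of `⋀ TM` is smooth if, in the trivialisation of `⋀ TM`
induced by the trivialisation of `TM` over any preferred chart, its components are smooth. -/
def IsSmoothMV (X : (p : M) → ExteriorAlgebra ℝ (TangentSpace (𝓡 n) p)) : Prop :=
  ∀ (p : M) (J : Finset (Fin n)),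
    ContMDiffAt (𝓡 n) 𝓘(ℝ, ℝ) ∞
      (fun q => (wedgeBasis n).repr (ExteriorAlgebra.map (triv p q) (X q)) J) p

variable (n M)

/-- `𝒜(M)`: the space of smooth sections of `⋀ TM = ⨁ₖ ⋀ᵏ TM`. -/
def MVF : Submodule ℝ ((p : M) → ExteriorAlgebra ℝ (TangentSpace (𝓡 n) p)) where
  carrier := {X | IsSmoothMV X}
  zero_mem' := fun p J => by
    simp only [Pi.zero_apply, map_zero, Finsupp.coe_zero]
    exact contMDiffAt_const
  add_mem' := fun {X Y} hX hY p J => by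
    simp only [Pi.add_apply, map_add, Finsupp.coe_add]
    exact (hX p J).add (hY p J)
  smul_mem' := fun c X hX p J => by
    simp only [Pi.smul_apply, map_smul, Finsupp.coe_smul]
    exact (contMDiffAt_const (I := 𝓡 n) (I' := 𝓘(ℝ, ℝ)) (c := c)).smul (hX p J)

variable {n M}

/-- The product `f X` of a smooth function and a multivector field. -/
instance : SMul (Fn n M) (MVF n M) where
  smul f X := ⟨fun p => f p • X.1 p, fun p J => by
    simp only [map_smul, Finsupp.coe_smul, Pi.smul_apply]
    exact (f.contMDiff p).smul (X.2 p J)⟩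

/-- `X ∈ Aᵏ(M)`: the multivector field `X` is a `k`-vector field. -/
def IsHom (k : ℕ) (X : MVF n M) : Prop :=
  ∀ p, X.1 p ∈ ⋀[ℝ]^k (TangentSpace (𝓡 n) p)

/-- A smooth function as an element of `A⁰(M)`. -/
def ofFn (f : Fn n M) : MVF n M :=
  ⟨fun p => algebraMap ℝ _ (f p), fun p J => by
    simp only [Algebra.algebraMap_eq_smul_one, map_smul, map_one, Finsupp.coe_smul, Pi.smul_apply]
    exact (f.contMDiff p).smul contMDiffAt_const⟩

lemma contMDiffAt_triv (V : VF n M) (p : M) :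
    ContMDiffAt (𝓡 n) 𝓘(ℝ, EuclideanSpace ℝ (Fin n)) ∞ (fun q => triv p q (V q)) p := by
  have h := (contMDiffAt_section (IB := 𝓡 n) (F := EuclideanSpace ℝ (Fin n))
    (E := fun p : M => TangentSpace (𝓡 n) p) (s := fun q => V q) p).1 (V.contMDiff p)
  refine h.congr_of_eventuallyEq ?_
  filter_upwards [(trivializationAt (EuclideanSpace ℝ (Fin n))
    (TangentSpace (𝓡 n) : M → Type _) p).open_baseSet.mem_nhds
    (FiberBundle.mem_baseSet_trivializationAt' p)] with q hq
  have hq' : q ∈ (chartAt (EuclideanSpace ℝ (Fin n)) p).source := hq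
  simp [triv, Trivialization.linearMapAt_apply, hq']

/-- A vector field as an element of `A¹(M)`. -/
def ofVF (V : VF n M) : MVF n M :=
  ⟨fun p => ExteriorAlgebra.ι ℝ (V p), fun p J => by
    simp only [ExteriorAlgebra.map_apply_ι]
    have h := contMDiffAt_triv V p
    let L : EuclideanSpace ℝ (Fin n) →L[ℝ] ℝ :=
      (((wedgeBasis n).coord J) ∘ₗ (ExteriorAlgebra.ι ℝ)).toContinuousLinearMap
    exact L.contMDiff.contMDiffAt.comp p h⟩

/-- The degree-one part of a multivector field, as a vector field; inverse to `ofVF` on `A¹(M)`. -/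
def toVF (X : MVF n M) : VF n M :=
  ⟨fun p => ExteriorAlgebra.ιInv (X.1 p), fun p => by
    rw [contMDiffAt_section]
    have hX : ∀ J, ContMDiffAt (𝓡 n) 𝓘(ℝ, ℝ) ∞ (fun q =>
      (wedgeBasis n).repr (ExteriorAlgebra.map (triv p q) (X.1 q)) J) p := X.2 p
    have h : ContMDiffAt (𝓡 n) 𝓘(ℝ, EuclideanSpace ℝ (Fin n)) ∞ (fun q => ∑ J : Finset (Fin n),
        (wedgeBasis n).repr (ExteriorAlgebra.map (triv p q) (X.1 q)) J •
          (ExteriorAlgebra.ιInv (wedgeBasis n J) : EuclideanSpace ℝ (Fin n))) p :=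
      contMDiffAt_finsetSum fun J _ => (hX J).smul contMDiffAt_const
    refine h.congr_of_eventuallyEq ?_
    filter_upwards [(trivializationAt (EuclideanSpace ℝ (Fin n))
      (TangentSpace (𝓡 n) : M → Type _) p).open_baseSet.mem_nhds
      (FiberBundle.mem_baseSet_trivializationAt' p)] with q hq
    have h1 : (∑ J : Finset (Fin n),
        (wedgeBasis n).repr (ExteriorAlgebra.map (triv p q) (X.1 q)) J •
          (ExteriorAlgebra.ιInv (wedgeBasis n J) : EuclideanSpace ℝ (Fin n)))
        = ExteriorAlgebra.ιInv (ExteriorAlgebra.map (triv p q) (X.1 q)) := by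
      conv_rhs => rw [← (wedgeBasis n).sum_repr (ExteriorAlgebra.map (triv p q) (X.1 q))]
      simp only [map_sum, map_smul]
    have h2 := LinearMap.congr_fun (ExteriorAlgebra.ιInv_comp_map (triv (n := n) p q)) (X.1 q)
    simp only [LinearMap.comp_apply, AlgHom.toLinearMap_apply] at h2
    rw [h1, h2]
    have hq' : q ∈ (chartAt (EuclideanSpace ℝ (Fin n)) p).source := hq
    simp [triv, Trivialization.linearMapAt_apply, hq']⟩

/-- The product `f V` of a smooth function and a vector field. -/
instance : SMul (Fn n M) (VF n M) where
  smul f V := ⟨fun p => f p • V p, f.contMDiff.smul_section V.contMDiff⟩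

/-- The representation of a section of `⋀ TM` in the preferred chart at `p`,
as a function `ℝⁿ → ⋀ ℝⁿ`. -/
def localRep (p : M) (X : (q : M) → ExteriorAlgebra ℝ (TangentSpace (𝓡 n) q))
    (u : EuclideanSpace ℝ (Fin n)) : ExteriorAlgebra ℝ (EuclideanSpace ℝ (Fin n)) :=
  ExteriorAlgebra.map (triv p ((extChartAt (𝓡 n) p).symm u)) (X ((extChartAt (𝓡 n) p).symm u))

/-- The Schouten–Nijenhuis bracket, given in local coordinates by
`[X, Y] = ∑ᵢ (X ⌊ dxⁱ) ∧ ∂ᵢY - ∂ᵢX ∧ (dxⁱ ⌋ Y)`.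
Its value at `p` is computed in the preferred chart at `p`. In particular `[X, f] = (-1)^(k-1) i_f X`
for a `k`-vector field `X` and a function `f`, and `[V, W]` is the Lie bracket of vector fields
for `V, W ∈ A¹(M)`. -/
def schouten (X Y : MVF n M) (p : M) : ExteriorAlgebra ℝ (TangentSpace (𝓡 n) p) :=
  let u := extChartAt (𝓡 n) p p
  let x := localRep p X.1
  let y := localRep p Y.1
  ExteriorAlgebra.map (trivSymm p p)
    (∑ i : Fin n, (contrR (x u) (dx i) * pderiv i y u - pderiv i x u * contrL (dx i) (y u)))

end Fields

/-! ### Affine connections and their extension to multivector fields -/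

section Affine

variable (n : ℕ) (M : Type*) [TopologicalSpace M] [ChartedSpace (EuclideanSpace ℝ (Fin n)) M]
  [IsManifold (𝓡 n) ∞ M]

/-- An affine connection on `TM`; `D V W` stands for `∇_V W`. -/
structure AffineConnection where
  toFun : VF n M → VF n M → VF n M
  add_left : ∀ V V' W, toFun (V + V') W = toFun V W + toFun V' W
  smul_left : ∀ (f : Fn n M) V W, toFun (f • V) W = f • toFun V W
  add_right : ∀ V W W', toFun V (W + W') = toFun V W + toFun V W'
  leibniz : ∀ V (f : Fn n M) W p,
    toFun V (f • W) p = mvfderiv (𝓡 n) f p (V p) • W p + f p • toFun V W p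

variable {n M}

/-- `D` is torsion-free: `D_V W - D_W V = [V, W]` (Lie bracket) for all vector fields `V, W`. -/
def AffineConnection.TorsionFree (D : AffineConnection n M) : Prop :=
  ∀ (V W : VF n M) (p : M),
    D.toFun V W p - D.toFun W V p - VectorField.mlieBracket (𝓡 n) (⇑V) (⇑W) p = 0

variable [T2Space M]

/-- A global vector field which, near `p`, is the `i`-th coordinate vector field of the preferred
chart at `p`. -/
def coordVF (p : M) (i : Fin n) : VF n M :=
  ⟨(Classical.arbitrary (SmoothBumpFunction (𝓡 n) p) : M → ℝ) • (fun q => trivSymm p q (stdBasis n i)), by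
    refine ContMDiffOn.smul_section_of_tsupport (u := (chartAt (EuclideanSpace ℝ (Fin n)) p).source)
      (SmoothBumpFunction.contMDiff _).contMDiffOn (chartAt _ p).open_source
      (SmoothBumpFunction.tsupport_subset_chartAt_source _) ?_
    intro q hq
    have hq' : q ∈ (trivializationAt (EuclideanSpace ℝ (Fin n))
      (TangentSpace (𝓡 n) : M → Type _) p).baseSet := hq
    rw [Trivialization.contMDiffWithinAt_section _ hq']
    refine (contMDiffWithinAt_const (c := stdBasis n i)).congr_of_mem (fun r hr => ?_) hq
    have hr' : r ∈ (trivializationAt (EuclideanSpace ℝ (Fin n))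
      (TangentSpace (𝓡 n) : M → Type _) p).baseSet := hr
    have e : trivSymm p r (stdBasis n i) = (trivializationAt (EuclideanSpace ℝ (Fin n))
        (TangentSpace (𝓡 n) : M → Type _) p).symm r (stdBasis n i) := by
      simp only [trivSymm, Trivialization.symmL]
      exact congrFun (Trivialization.coe_symmₗ (R := ℝ) _ hr') _
    rw [e]
    exact congrArg Prod.snd ((trivializationAt (EuclideanSpace ℝ (Fin n))
      (TangentSpace (𝓡 n) : M → Type _) p).apply_mk_symm hr' (stdBasis n i))⟩

/-- The vector `Γᵢⱼ = (∇_{∂ᵢ} ∂ⱼ)(p)` of Christoffel symbols in the preferred chart at `p`. -/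
def christoffel (D : AffineConnection n M) (p : M) (i j : Fin n) : EuclideanSpace ℝ (Fin n) :=
  triv p p (D.toFun (coordVF p i) (coordVF p j) p)

/-- The coordinates of `(D_{∂ᵢ} Y)(p)`, where `D_{∂ᵢ}` is the extension of the affine connection
to `⋀ TM` as a derivation of the wedge product: `∂ᵢY + ∑ⱼ Γᵢⱼ ∧ (dxʲ ⌋ Y)`. -/
def covDeriv (D : AffineConnection n M) (Y : MVF n M) (p : M) (i : Fin n) :
    ExteriorAlgebra ℝ (EuclideanSpace ℝ (Fin n)) :=
  let u := extChartAt (𝓡 n) p p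
  let y := localRep p Y.1
  pderiv i y u + ∑ j : Fin n, ExteriorAlgebra.ι ℝ (christoffel D p i j) * contrL (dx j) (y u)

/-- The extension `D_X Y` of an affine connection to multivector fields: the map determined by
`D_X Y = ∑ⱼ (-1)^(k-j) X₁ ∧ ⋯ X̂ⱼ ⋯ ∧ Xₖ ∧ D_{Xⱼ} Y` for `X = X₁ ∧ ⋯ ∧ Xₖ`, that is
`D_X Y = ∑ᵢ (X ⌊ dxⁱ) ∧ D_{∂ᵢ} Y`. -/
def AffineConnection.induced (D : AffineConnection n M) (X Y : MVF n M) (p : M) :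
    ExteriorAlgebra ℝ (TangentSpace (𝓡 n) p) :=
  let u := extChartAt (𝓡 n) p p
  ExteriorAlgebra.map (trivSymm p p)
    (∑ i : Fin n, contrR (localRep p X.1 u) (dx i) * covDeriv D Y p i)

end Affine

/-! ### Higher connections -/

section Higher

variable (n : ℕ) (M : Type*) [TopologicalSpace M] [ChartedSpace (EuclideanSpace ℝ (Fin n)) M]
  [IsManifold (𝓡 n) ∞ M]

/-- A higher affine connection `(X, Y) ↦ ∇_X Y` on `M`. In the field `degree`, the case
`k = l = 0` (where `∇_X Y ∈ A⁻¹(M) = 0`) is covered by `fn_left`. -/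
structure HigherConnection where
  toFun : MVF n M → MVF n M → MVF n M
  degree : ∀ (k l m : ℕ) (X Y : MVF n M), k + l = m + 1 → IsHom k X → IsHom l Y →
    IsHom m (toFun X Y)
  linear_left : ∀ (f : Fn n M) (X X' Y : MVF n M),
    toFun (f • X + X') Y = f • toFun X Y + toFun X' Y
  add_right : ∀ X Y Y' : MVF n M, toFun X (Y + Y') = toFun X Y + toFun X Y'
  apply_fn : ∀ (k : ℕ) (X : MVF n M) (f : Fn n M), IsHom k X →
    ∀ p, (toFun X (ofFn f)).1 p = schouten X (ofFn f) p
  leibniz : ∀ (k : ℕ) (X : MVF n M) (f : Fn n M) (Y : MVF n M), IsHom k X →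
    ∀ p, (toFun X (f • Y)).1 p = schouten X (ofFn f) p * Y.1 p + f p • (toFun X Y).1 p
  fn_left : ∀ (f : Fn n M) (X : MVF n M), toFun (ofFn f) X = 0

variable {n M}

/-- The sign `(-1)^((k-1)(l-1))`. -/
def sgn (k l : ℕ) : ℝ := (-1 : ℝ) ^ (((k : ℤ) - 1) * ((l : ℤ) - 1))

/-- The higher torsion `T(X, Y) = ∇_X Y - (-1)^((k-1)(l-1)) ∇_Y X - [X, Y]` for `X ∈ Aᵏ(M)`,
`Y ∈ Aˡ(M)`. -/
def HigherConnection.torsion (C : HigherConnection n M) (k l : ℕ) (X Y : MVF n M) (p : M) :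
    ExteriorAlgebra ℝ (TangentSpace (𝓡 n) p) :=
  (C.toFun X Y).1 p - sgn k l • (C.toFun Y X).1 p - schouten X Y p

/-- A higher connection is torsion-free if its higher torsion vanishes identically. -/
def HigherConnection.TorsionFree (C : HigherConnection n M) : Prop :=
  ∀ (k l : ℕ) (X Y : MVF n M), IsHom k X → IsHom l Y → ∀ p, C.torsion k l X Y p = 0

lemma isHom_ofVF (V : VF n M) : IsHom 1 (ofVF V) := fun p => by
  simp [ofVF]

lemma ofVF_add (V W : VF n M) : ofVF (V + W) = ofVF V + ofVF W :=
  Subtype.ext (funext fun p => map_add (ExteriorAlgebra.ι ℝ) (V p) (W p))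

lemma ofVF_smul (f : Fn n M) (V : VF n M) : ofVF (f • V) = f • ofVF V :=
  Subtype.ext (funext fun p => map_smul (ExteriorAlgebra.ι ℝ) (f p) (V p))

lemma toVF_add (X Y : MVF n M) : toVF (X + Y) = toVF X + toVF Y :=
  ContMDiffSection.ext fun p => map_add ExteriorAlgebra.ιInv (X.1 p) (Y.1 p)

lemma toVF_smul (f : Fn n M) (X : MVF n M) : toVF (f • X) = f • toVF X :=
  ContMDiffSection.ext fun p => map_smul ExteriorAlgebra.ιInv (f p) (X.1 p)

lemma pderiv_algebraMap {i : Fin n} {g : EuclideanSpace ℝ (Fin n) → ℝ}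
    {u : EuclideanSpace ℝ (Fin n)} (hg : DifferentiableAt ℝ g u) :
    pderiv i (fun w => algebraMap ℝ _ (g w)) u = algebraMap ℝ _ (fderiv ℝ g u (stdBasis n i)) := by
  have h : ∀ J, fderiv ℝ (fun w => (wedgeBasis n).repr (algebraMap ℝ _ (g w)) J) u (stdBasis n i)
      = fderiv ℝ g u (stdBasis n i) * (wedgeBasis n).repr 1 J := fun J => by
    simp only [Algebra.algebraMap_eq_smul_one, map_smul, Finsupp.coe_smul, Pi.smul_apply,
      smul_eq_mul]
    rw [fderiv_mul_const hg]
    simp [mul_comm]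
  simp only [pderiv, h, mul_smul, ← Finset.smul_sum, (wedgeBasis n).sum_repr]
  rw [Algebra.algebraMap_eq_smul_one]

lemma schouten_ofVF_ofFn (V : VF n M) (f : Fn n M) (p : M) :
    schouten (ofVF V) (ofFn f) p = algebraMap ℝ _ (mvfderiv (𝓡 n) f p (V p)) := by
  have hx : localRep p (ofVF V).1 (extChartAt (𝓡 n) p p)
      = ExteriorAlgebra.ι ℝ (triv p p (V p)) := by
    unfold localRep
    rw [extChartAt_to_inv p]
    exact ExteriorAlgebra.map_apply_ι _ _
  have hy : localRep p (ofFn f).1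
      = fun w => algebraMap ℝ _ (f ((extChartAt (𝓡 n) p).symm w)) := by
    funext w
    exact AlgHom.commutes _ _
  have hd : MDifferentiableAt (𝓡 n) 𝓘(ℝ, ℝ) f p :=
    (f.contMDiff p).mdifferentiableAt (by simp)
  have hg : DifferentiableAt ℝ (fun w => f ((extChartAt (𝓡 n) p).symm w))
      (extChartAt (𝓡 n) p p) := by
    have := hd.differentiableWithinAt_writtenInExtChartAt
    rw [ModelWithCorners.range_eq_univ, differentiableWithinAt_univ] at this
    exact this
  have htriv : triv p p (V p) = V p := by
    have := (tangentBundleCore (𝓡 n) M).coordChange_self (achart _ p) p (mem_chart_source _ p) (V p)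
    rw [← TangentBundle.continuousLinearMapAt_trivializationAt_eq_core (mem_chart_source _ p)]
      at this
    exact this
  have hm : mvfderiv (𝓡 n) f p (V p)
      = fderiv ℝ (fun w => f ((extChartAt (𝓡 n) p).symm w)) (extChartAt (𝓡 n) p p)
          (triv p p (V p)) := by
    rw [htriv]
    have h1 : mfderiv (𝓡 n) 𝓘(ℝ, ℝ) f p = fderivWithin ℝ (writtenInExtChartAt (𝓡 n) 𝓘(ℝ, ℝ) p f)
        (Set.range (𝓡 n)) (extChartAt (𝓡 n) p p) := if_pos hd
    rw [ModelWithCorners.range_eq_univ, fderivWithin_univ] at h1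
    unfold mvfderiv
    rw [h1]
    rfl
  have hR : ∀ v (i : Fin n), contrR (ExteriorAlgebra.ι ℝ v) (dx i) = algebraMap ℝ _ (dx i v) :=
    fun v i => CliffordAlgebra.contractRight_ι 0 (dx i) v
  have hL : ∀ c (i : Fin n), contrL (dx i) (algebraMap ℝ _ c) = 0 :=
    fun c i => CliffordAlgebra.contractLeft_algebraMap 0 (dx i) c
  simp only [schouten, hx, hy, hR, hL, mul_zero, sub_zero, pderiv_algebraMap hg, ← map_mul,
    ← map_sum, AlgHom.commutes, hm]
  congr 1
  conv_rhs => rw [← (stdBasis n).sum_repr (triv p p (V p))]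
  simp only [dx, Module.Basis.coord_apply, map_sum, map_smul, smul_eq_mul]

lemma ιInv_algebraMap_mul {W : Type*} [AddCommGroup W] [Module ℝ W] (c : ℝ) (w : W) :
    ExteriorAlgebra.ιInv (algebraMap ℝ (ExteriorAlgebra ℝ W) c * ExteriorAlgebra.ι ℝ w) = c • w := by
  rw [← Algebra.smul_def, map_smul, ExteriorAlgebra.ι_leftInverse]

/-- The affine connection underlying a higher connection: its restriction to `A¹(M) × A¹(M)`. -/
def HigherConnection.underlying (C : HigherConnection n M) : AffineConnection n M where
  toFun V W := toVF (C.toFun (ofVF V) (ofVF W))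
  add_left V V' W := by
    have h1 : (1 : Fn n M) • ofVF V = ofVF V := Subtype.ext (funext fun p => one_smul ℝ _)
    have h2 : (1 : Fn n M) • C.toFun (ofVF V) (ofVF W) = C.toFun (ofVF V) (ofVF W) :=
      Subtype.ext (funext fun p => one_smul ℝ _)
    have h := C.linear_left 1 (ofVF V) (ofVF V') (ofVF W)
    rw [h1, h2] at h
    rw [ofVF_add, h, toVF_add]
  smul_left f V W := by
    have h0 := C.fn_left 0 (ofVF W)
    have h1 : ofFn (0 : Fn n M) = 0 := Subtype.ext (funext fun p => map_zero (algebraMap ℝ _))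
    have h := C.linear_left f (ofVF V) 0 (ofVF W)
    rw [h1] at h0
    rw [add_zero, h0, add_zero] at h
    rw [ofVF_smul, h, toVF_smul]
  add_right V W W' := by
    rw [ofVF_add, C.add_right, toVF_add]
  leibniz V f W p := by
    have h := C.leibniz 1 (ofVF V) f (ofVF W) (isHom_ofVF V) p
    rw [schouten_ofVF_ofFn] at h
    rw [ofVF_smul]
    change ExteriorAlgebra.ιInv ((C.toFun (ofVF V) (f • ofVF W)).1 p) = _
    rw [h, map_add, map_smul]
    exact congrArg (· + _) (ιInv_algebraMap_mul _ _)

variable [T2Space M]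

/-- The twist fields `F^{k,l}(X, Y) = ∇_X Y - D_X Y` for `X ∈ Aᵏ(M)` and `Y ∈ Aˡ(M)`, where `D` is
the extension of the underlying affine connection to multivector fields; `F^{k,l}` is the
restriction of this map to `Aᵏ(M) × Aˡ(M)`, and it vanishes for `k = 0` or `l = 0`. -/
def HigherConnection.twist (C : HigherConnection n M) (X Y : MVF n M) (p : M) :
    ExteriorAlgebra ℝ (TangentSpace (𝓡 n) p) :=
  (C.toFun X Y).1 p - C.underlying.induced X Y p

end Higher

end HigherConn

end

/-!
In a chart write `Xⁱ = X ⌊ dxⁱ` and `ᵢX = dxⁱ ⌋ X`. The extension of an affine connection is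
`D_X Y = ∑ᵢ Xⁱ ∧ (∂ᵢY + ∑ⱼ Γᵢⱼ ∧ ⱼY)`, and the sign `(-1)^((k-1)(l-1))` is exactly the one for which
`(-1)^((k-1)(l-1)) Yⁱ ∧ Z = Z ∧ ᵢY` for a `k`-vector `Z` and an `l`-vector `Y`. Therefore the
derivative terms of `D_X Y - (-1)^((k-1)(l-1)) D_Y X` add up to the Schouten–Nijenhuis bracket,
while, since `Xⁱ ∧ Γ = Γ ∧ ᵢX`, the Christoffel terms add up to `∑ᵢⱼ (Γᵢⱼ - Γⱼᵢ) ∧ ᵢX ∧ ⱼY`. When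
`D` is torsion-free the latter sum vanishes, so the higher torsion of `∇ = D + F` is
`F(X, Y) - (-1)^((k-1)(l-1)) F(Y, X)`. Conversely, the higher torsion in degrees `k = l = 1` is
the torsion of `D`.
-/

namespace HigherConn

open CliffordAlgebra (contractLeft contractRight involute)

section CliffordContraction

variable {R W : Type*} [CommRing R] [AddCommGroup W] [Module R W] {Q : QuadraticForm R W}

lemma contractLeft_mul (α : Module.Dual R W) (b c : CliffordAlgebra Q) :
    contractLeft α (b * c) = contractLeft α b * c + involute b * contractLeft α c := by
  induction b using CliffordAlgebra.left_induction with
  | algebraMap r =>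
    rw [CliffordAlgebra.contractLeft_algebraMap_mul, CliffordAlgebra.contractLeft_algebraMap,
      zero_mul, zero_add, AlgHom.commutes]
  | add x y hx hy => simp only [add_mul, map_add, hx, hy]; abel
  | ι_mul x v hx =>
    simp only [mul_assoc, CliffordAlgebra.contractLeft_ι_mul, hx, map_mul,
      CliffordAlgebra.involute_ι, sub_mul, smul_mul_assoc, mul_add, neg_mul]
    abel

lemma contractRight_eq_involute_contractLeft (α : Module.Dual R W) (x : CliffordAlgebra Q) :
    contractRight x α = involute (contractLeft α x) := by
  induction x using CliffordAlgebra.right_induction with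
  | algebraMap r =>
    rw [CliffordAlgebra.contractRight_algebraMap, CliffordAlgebra.contractLeft_algebraMap, map_zero]
  | add x y hx hy => simp only [map_add, LinearMap.add_apply, hx, hy]
  | mul_ι v x hx =>
    rw [CliffordAlgebra.contractRight_mul_ι, hx, contractLeft_mul, CliffordAlgebra.contractLeft_ι,
      ← Algebra.commutes, ← Algebra.smul_def, map_add, map_mul, map_smul,
      CliffordAlgebra.involute_involute, CliffordAlgebra.involute_ι, mul_neg]
    abel

end CliffordContraction

section ExteriorAlgebra

variable {R V W : Type*} [CommRing R] [AddCommGroup V] [Module R V] [AddCommGroup W] [Module R W]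

lemma ι_mul_eq_involute_mul_ι (v : W) (x : ExteriorAlgebra R W) :
    ExteriorAlgebra.ι R v * x = involute x * ExteriorAlgebra.ι R v := by
  induction x using CliffordAlgebra.left_induction with
  | algebraMap r => rw [AlgHom.commutes, Algebra.commutes]
  | add x y hx hy => simp only [map_add, add_mul, mul_add, hx, hy]
  | ι_mul x w hx =>
    have hanti : ExteriorAlgebra.ι R v * ExteriorAlgebra.ι R w =
        -(ExteriorAlgebra.ι R w * ExteriorAlgebra.ι R v) :=
      eq_neg_of_add_eq_zero_left (ExteriorAlgebra.ι_add_mul_swap v w)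
    change ExteriorAlgebra.ι R v * (ExteriorAlgebra.ι R w * x) = _
    rw [← mul_assoc, hanti, neg_mul, mul_assoc, hx, map_mul, CliffordAlgebra.involute_ι, neg_mul,
      neg_mul, mul_assoc]

lemma contractRight_mul_ι_eq_ι_mul_contractLeft (α : Module.Dual R W) (x : ExteriorAlgebra R W)
    (v : W) :
    contractRight x α * ExteriorAlgebra.ι R v = ExteriorAlgebra.ι R v * contractLeft α x := by
  rw [contractRight_eq_involute_contractLeft, ι_mul_eq_involute_mul_ι]

lemma ι_mul_mem_exteriorPower_succ (v : W) {k : ℕ} {x : ExteriorAlgebra R W}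
    (hx : x ∈ ⋀[R]^k W) : ExteriorAlgebra.ι R v * x ∈ ⋀[R]^(k + 1) W := by
  rw [ExteriorAlgebra.exteriorPower, pow_succ']
  exact Submodule.mul_mem_mul ⟨v, rfl⟩ hx

lemma map_mem_exteriorPower (f : V →ₗ[R] W) {k : ℕ} {x : ExteriorAlgebra R V}
    (hx : x ∈ ⋀[R]^k V) : ExteriorAlgebra.map f x ∈ ⋀[R]^k W := by
  have hle : (⋀[R]^k V).map (ExteriorAlgebra.map f).toLinearMap ≤ ⋀[R]^k W := by
    rw [ExteriorAlgebra.exteriorPower, Submodule.map_pow]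
    refine pow_le_pow_left' ?_ k
    rw [ExteriorAlgebra.ι_range_map_map]
    exact LinearMap.map_le_range
  exact hle (Submodule.mem_map_of_mem hx)

lemma involute_eq_smul_of_mem_exteriorPower {k : ℕ} {x : ExteriorAlgebra R W}
    (hx : x ∈ ⋀[R]^k W) : involute x = (-1 : R) ^ k • x := by
  induction hx using Submodule.pow_induction_on_left' with
  | algebraMap r => rw [AlgHom.commutes, pow_zero, one_smul]
  | add x y i _ _ hx hy => rw [map_add, hx, hy, smul_add]
  | mem_mul _ hm i x _ hx =>
    obtain ⟨v, rfl⟩ := hm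
    have hv : involute (ExteriorAlgebra.ι R v) = -ExteriorAlgebra.ι R v :=
      CliffordAlgebra.involute_ι v
    rw [map_mul, hx, hv, mul_smul_comm, pow_succ, mul_neg_one, neg_smul, neg_mul, smul_neg]

lemma mul_eq_smul_mul_of_mem_exteriorPower {p q : ℕ} {a b : ExteriorAlgebra R W}
    (ha : a ∈ ⋀[R]^p W) (hb : b ∈ ⋀[R]^q W) : a * b = (-1 : R) ^ (p * q) • (b * a) := by
  induction ha using Submodule.pow_induction_on_left' with
  | algebraMap r => rw [zero_mul, pow_zero, one_smul, Algebra.commutes]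
  | add x y i _ _ hx hy => rw [add_mul, hx, hy, mul_add, smul_add]
  | mem_mul _ hm i x _ hx =>
    obtain ⟨v, rfl⟩ := hm
    rw [mul_assoc, hx, mul_smul_comm, ← mul_assoc, ι_mul_eq_involute_mul_ι,
      involute_eq_smul_of_mem_exteriorPower hb, smul_mul_assoc, smul_mul_assoc, smul_smul,
      mul_assoc, ← pow_add, Nat.succ_mul]

lemma contractLeft_eq_zero_of_mem_exteriorPower_zero (α : Module.Dual R W)
    {x : ExteriorAlgebra R W} (hx : x ∈ ⋀[R]^0 W) : contractLeft α x = 0 := by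
  obtain ⟨r, rfl⟩ := Submodule.mem_one.1 hx
  exact CliffordAlgebra.contractLeft_algebraMap _ _ _

lemma contractLeft_mem_exteriorPower (α : Module.Dual R W) {k : ℕ} {x : ExteriorAlgebra R W}
    (hx : x ∈ ⋀[R]^(k + 1) W) : contractLeft α x ∈ ⋀[R]^k W := by
  rw [ExteriorAlgebra.exteriorPower, pow_succ'] at hx
  induction hx using Submodule.mul_induction_on' with
  | add x _ y _ hx hy => rw [map_add]; exact add_mem hx hy
  | mem_mul_mem _ hm x hx =>
    obtain ⟨v, rfl⟩ := hm
    have hcontract : contractLeft α (ExteriorAlgebra.ι R v * x) =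
        α v • x - ExteriorAlgebra.ι R v * contractLeft α x :=
      CliffordAlgebra.contractLeft_ι_mul _ _ _
    rw [hcontract]
    refine sub_mem (Submodule.smul_mem _ _ hx) ?_
    cases k with
    | zero =>
      rw [contractLeft_eq_zero_of_mem_exteriorPower_zero α hx, mul_zero]
      exact zero_mem _
    | succ k => exact ι_mul_mem_exteriorPower_succ v (contractLeft_mem_exteriorPower α hx)

lemma ι_mul_contractLeft_mem_exteriorPower (α : Module.Dual R W) (v : W) {k : ℕ}
    {x : ExteriorAlgebra R W} (hx : x ∈ ⋀[R]^k W) :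
    ExteriorAlgebra.ι R v * contractLeft α x ∈ ⋀[R]^k W := by
  cases k with
  | zero =>
    rw [contractLeft_eq_zero_of_mem_exteriorPower_zero α hx, mul_zero]
    exact zero_mem _
  | succ k => exact ι_mul_mem_exteriorPower_succ v (contractLeft_mem_exteriorPower α hx)

lemma contractRight_mul_eq_smul_mul_contractLeft (α : Module.Dual R W) {k m : ℕ}
    {y z : ExteriorAlgebra R W} (hy : y ∈ ⋀[R]^(m + 1) W) (hz : z ∈ ⋀[R]^k W) :
    contractRight y α * z = (-1 : R) ^ ((k + 1) * m) • (z * contractLeft α y) := by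
  have hy' := contractLeft_mem_exteriorPower α hy
  rw [contractRight_eq_involute_contractLeft, involute_eq_smul_of_mem_exteriorPower hy',
    smul_mul_assoc, mul_eq_smul_mul_of_mem_exteriorPower hy' hz, smul_smul, ← pow_add]
  congr 2
  ring

variable {I : Type*} [LinearOrder I] (b : Module.Basis I R W)

lemma exteriorAlgebra_basis_mem_exteriorPower (J : Finset I) :
    b.ExteriorAlgebra J ∈ ⋀[R]^J.card W := by
  rw [ExteriorAlgebra.basis_apply]
  exact ExteriorAlgebra.ιMulti_range R _ ⟨_, rfl⟩

lemma exteriorAlgebra_basis_repr_eq_zero {k : ℕ} {x : ExteriorAlgebra R W}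
    (hx : x ∈ ⋀[R]^k W) {J : Finset I} (hJ : J.card ≠ k) : b.ExteriorAlgebra.repr x J = 0 := by
  rw [Module.Basis.ExteriorAlgebra, Module.Basis.repr_reindex_apply]
  exact DirectSum.IsInternal.collectedBasis_repr_of_mem_ne _ b.exteriorPower hJ.symm hx

end ExteriorAlgebra

section Sign

lemma sgn_succ (k m : ℕ) : sgn k (m + 1) = (-1) ^ ((k + 1) * m) := by
  have hexp : ((k : ℤ) - 1) * (((m + 1 : ℕ) : ℤ) - 1) = ((k + 1) * m : ℕ) + 2 * -(m : ℤ) := by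
    push_cast
    ring
  rw [sgn, hexp, zpow_add₀ (by norm_num), zpow_natCast, zpow_mul]
  norm_num

variable {W : Type*} [AddCommGroup W] [Module ℝ W]

lemma sgn_smul_contractRight_mul (α : Module.Dual ℝ W) {k l : ℕ} {y z : ExteriorAlgebra ℝ W}
    (hy : y ∈ ⋀[ℝ]^l W) (hz : z ∈ ⋀[ℝ]^k W) :
    sgn k l • (contractRight y α * z) = z * contractLeft α y := by
  cases l with
  | zero =>
    rw [contractRight_eq_involute_contractLeft, contractLeft_eq_zero_of_mem_exteriorPower_zero α hy,
      map_zero, zero_mul, mul_zero, smul_zero]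
  | succ m =>
    rw [contractRight_mul_eq_smul_mul_contractLeft α hy hz, sgn_succ, smul_smul, ← mul_pow,
      neg_one_mul, neg_neg, one_pow, one_smul]

end Sign

section PartialDerivative

variable {n : ℕ}

lemma pderiv_mem_exteriorPower {k : ℕ}
    {f : EuclideanSpace ℝ (Fin n) → ExteriorAlgebra ℝ (EuclideanSpace ℝ (Fin n))}
    (hf : ∀ u, f u ∈ ⋀[ℝ]^k (EuclideanSpace ℝ (Fin n))) (i : Fin n)
    (u : EuclideanSpace ℝ (Fin n)) : pderiv i f u ∈ ⋀[ℝ]^k (EuclideanSpace ℝ (Fin n)) := by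
  refine Submodule.sum_mem _ fun J _ => ?_
  by_cases hJ : J.card = k
  · exact Submodule.smul_mem _ _ (hJ ▸ exteriorAlgebra_basis_mem_exteriorPower _ J)
  · have hrepr (w) : (wedgeBasis n).repr (f w) J = 0 :=
      exteriorAlgebra_basis_repr_eq_zero _ (hf w) hJ
    simp only [hrepr, fderiv_fun_const, Pi.zero_apply, zero_apply, zero_smul, zero_mem]

lemma pderiv_linearMap_comp {F : Type*} [NormedAddCommGroup F] [NormedSpace ℝ F]
    [FiniteDimensional ℝ F] (L : F →ₗ[ℝ] ExteriorAlgebra ℝ (EuclideanSpace ℝ (Fin n))) (i : Fin n)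
    {g : EuclideanSpace ℝ (Fin n) → F} {u : EuclideanSpace ℝ (Fin n)}
    (hg : DifferentiableAt ℝ g u) :
    pderiv i (fun w => L (g w)) u = L (fderiv ℝ g u (stdBasis n i)) := by
  have hcoord (J : Finset (Fin n)) :
      fderiv ℝ (fun w => (wedgeBasis n).repr (L (g w)) J) u (stdBasis n i) =
        (wedgeBasis n).repr (L (fderiv ℝ g u (stdBasis n i))) J := by
    let coordL : F →L[ℝ] ℝ := ((wedgeBasis n).coord J ∘ₗ L).toContinuousLinearMap
    exact DFunLike.congr_fun (coordL.hasFDerivAt.comp u hg.hasFDerivAt).fderiv (stdBasis n i)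
  simp only [pderiv, hcoord, (wedgeBasis n).sum_repr]

end PartialDerivative

section Charts

variable {n : ℕ} {M : Type*} [TopologicalSpace M] [ChartedSpace (EuclideanSpace ℝ (Fin n)) M]

lemma extChartAt_symm_mem_chartAt_source {p : M} {u : EuclideanSpace ℝ (Fin n)}
    (hu : u ∈ (extChartAt (𝓡 n) p).target) :
    (extChartAt (𝓡 n) p).symm u ∈ (chartAt (EuclideanSpace ℝ (Fin n)) p).source := by
  rw [← extChartAt_source (𝓡 n)]
  exact (extChartAt (𝓡 n) p).map_target hu

variable [IsManifold (𝓡 n) ∞ M]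

lemma triv_eq_mfderiv_extChartAt {p q : M}
    (hq : q ∈ (chartAt (EuclideanSpace ℝ (Fin n)) p).source) (v : TangentSpace (𝓡 n) q) :
    triv p q v = mfderiv (𝓡 n) 𝓘(ℝ, EuclideanSpace ℝ (Fin n)) (extChartAt (𝓡 n) p) q v := by
  rw [triv, TangentBundle.continuousLinearMapAt_trivializationAt hq]
  rfl

lemma triv_self (p : M) (v : TangentSpace (𝓡 n) p) : triv p p v = v := by
  rw [triv_eq_mfderiv_extChartAt (mem_chart_source _ p), mfderiv_extChartAt_self]
  rfl

lemma triv_trivSymm {p q : M} (hq : q ∈ (chartAt (EuclideanSpace ℝ (Fin n)) p).source)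
    (v : EuclideanSpace ℝ (Fin n)) : triv p q (trivSymm p q v) = v :=
  Trivialization.continuousLinearMapAt_symmL (R := ℝ) (trivializationAt (EuclideanSpace ℝ (Fin n))
    (TangentSpace (𝓡 n) : M → Type _) p) hq v

lemma trivSymm_self (p : M) (v : EuclideanSpace ℝ (Fin n)) :
    trivSymm p p v = (v : TangentSpace (𝓡 n) p) :=
  (triv_self p _).symm.trans (triv_trivSymm (mem_chart_source _ p) v)

/-- The representation of a vector field in the preferred chart at `p`, as a function `ℝⁿ → ℝⁿ`;
the analogue of `localRep` for vector fields that are not viewed as elements of `⋀ TM`. -/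
noncomputable def localVF (p : M) (V : VF n M) (u : EuclideanSpace ℝ (Fin n)) :
    EuclideanSpace ℝ (Fin n) :=
  triv p ((extChartAt (𝓡 n) p).symm u) (V ((extChartAt (𝓡 n) p).symm u))

lemma localRep_ofVF (p : M) (V : VF n M) :
    localRep p (ofVF V).1 = fun u => ExteriorAlgebra.ι ℝ (localVF p V u) :=
  funext fun _ => ExteriorAlgebra.map_apply_ι _ _

lemma differentiableAt_localVF (p : M) (V : VF n M) :
    DifferentiableAt ℝ (localVF p V) (extChartAt (𝓡 n) p p) := by
  have hdiff := ((contMDiffAt_triv V p).mdifferentiableAt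
    (by simp)).differentiableWithinAt_writtenInExtChartAt
  rw [ModelWithCorners.range_eq_univ, differentiableWithinAt_univ] at hdiff
  exact hdiff

lemma localRep_mem_exteriorPower {k : ℕ} {X : MVF n M} (hX : IsHom k X) (p : M)
    (u : EuclideanSpace ℝ (Fin n)) : localRep p X.1 u ∈ ⋀[ℝ]^k (EuclideanSpace ℝ (Fin n)) :=
  map_mem_exteriorPower _ (hX _)

lemma mpullbackWithin_extChartAt_symm_eventuallyEq_localVF (p : M) (V : VF n M) :
    VectorField.mpullbackWithin 𝓘(ℝ, EuclideanSpace ℝ (Fin n)) (𝓡 n) (extChartAt (𝓡 n) p).symm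
      (⇑V) (Set.range (𝓡 n)) =ᶠ[𝓝 (extChartAt (𝓡 n) p p)] localVF p V := by
  filter_upwards [extChartAt_target_mem_nhds p] with u hu
  rw [VectorField.mpullbackWithin_apply, localVF,
    triv_eq_mfderiv_extChartAt (extChartAt_symm_mem_chartAt_source hu),
    ContinuousLinearMap.inverse_eq
      (mfderivWithin_extChartAt_symm_comp_mfderiv_extChartAt hu)
      (mfderiv_extChartAt_comp_mfderivWithin_extChartAt_symm hu)]
  rfl

lemma mlieBracket_eq_lieBracket_localVF (p : M) (V W : VF n M) :
    VectorField.mlieBracket (𝓡 n) (⇑V) (⇑W) p =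
      (VectorField.lieBracket ℝ (localVF p V) (localVF p W) (extChartAt (𝓡 n) p p) :
        EuclideanSpace ℝ (Fin n)) := by
  rw [← VectorField.mlieBracketWithin_univ, VectorField.mlieBracketWithin_apply,
    mfderiv_extChartAt_self]
  refine (DFunLike.congr_fun ContinuousLinearMap.inverse_id _).trans ?_
  have hV := mpullbackWithin_extChartAt_symm_eventuallyEq_localVF p V
  have hW := mpullbackWithin_extChartAt_symm_eventuallyEq_localVF p W
  refine (hV.lieBracketWithin_vectorField_eq_nhds hW).trans ?_
  rw [Set.preimage_univ, Set.univ_inter, ModelWithCorners.range_eq_univ,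
    VectorField.lieBracketWithin_univ]

lemma schouten_ofVF (V W : VF n M) (p : M) :
    schouten (ofVF V) (ofVF W) p =
      ExteriorAlgebra.ι ℝ (VectorField.mlieBracket (𝓡 n) (⇑V) (⇑W) p) := by
  have contrR_ι (v) (i : Fin n) : contrR (ExteriorAlgebra.ι ℝ v) (dx i) = algebraMap ℝ _ (dx i v) :=
    CliffordAlgebra.contractRight_ι 0 (dx i) v
  have contrL_ι (v) (i : Fin n) : contrL (dx i) (ExteriorAlgebra.ι ℝ v) = algebraMap ℝ _ (dx i v) :=
    CliffordAlgebra.contractLeft_ι 0 (dx i) v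
  have sum_dx_smul (v) : ∑ i, dx i v • stdBasis n i = v := (stdBasis n).sum_repr v
  rw [mlieBracket_eq_lieBracket_localVF, VectorField.lieBracket_eq]
  simp only [schouten, localRep_ofVF, contrR_ι, contrL_ι,
    pderiv_linearMap_comp (ExteriorAlgebra.ι ℝ) _ (differentiableAt_localVF p _),
    ← Algebra.commutes, ← Algebra.smul_def, ← map_smul, ← map_sub, ← map_sum,
    Finset.sum_sub_distrib, sum_dx_smul, ExteriorAlgebra.map_apply_ι, trivSymm_self]

lemma HigherConnection.ιInv_torsion_ofVF (C : HigherConnection n M) (V W : VF n M) (p : M) :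
    ExteriorAlgebra.ιInv (C.torsion 1 1 (ofVF V) (ofVF W) p) =
      C.underlying.toFun V W p - C.underlying.toFun W V p -
        VectorField.mlieBracket (𝓡 n) (⇑V) (⇑W) p := by
  rw [HigherConnection.torsion, schouten_ofVF, sgn_succ, mul_zero, pow_zero, one_smul, map_sub,
    map_sub, ExteriorAlgebra.ι_leftInverse]
  rfl

lemma HigherConnection.TorsionFree.underlying {C : HigherConnection n M} (hC : C.TorsionFree) :
    C.underlying.TorsionFree := fun V W p => by
  rw [← C.ιInv_torsion_ofVF, hC 1 1 _ _ (isHom_ofVF V) (isHom_ofVF W), map_zero]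

end Charts

section InducedConnection

variable {n : ℕ} {M : Type*} [TopologicalSpace M] [ChartedSpace (EuclideanSpace ℝ (Fin n)) M]
  [IsManifold (𝓡 n) ∞ M] [T2Space M]

lemma localVF_coordVF_eventuallyEq (p : M) (i : Fin n) :
    localVF p (coordVF p i) =ᶠ[𝓝 (extChartAt (𝓡 n) p p)] fun _ => stdBasis n i := by
  let f : SmoothBumpFunction (𝓡 n) p := Classical.arbitrary _
  have htendsto : Filter.Tendsto (extChartAt (𝓡 n) p).symm (𝓝 (extChartAt (𝓡 n) p p)) (𝓝 p) := by
    simpa only [ContinuousAt, extChartAt_to_inv] using continuousAt_extChartAt_symm (I := 𝓡 n) p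
  filter_upwards [extChartAt_target_mem_nhds p, htendsto.eventually f.eventuallyEq_one]
    with u hu hf
  change triv p _ (f ((extChartAt (𝓡 n) p).symm u) • trivSymm p _ (stdBasis n i)) = _
  rw [hf, map_smul, triv_trivSymm (extChartAt_symm_mem_chartAt_source hu)]
  exact one_smul ℝ _

lemma mlieBracket_coordVF (p : M) (i j : Fin n) :
    VectorField.mlieBracket (𝓡 n) (⇑(coordVF p i)) (⇑(coordVF p j)) p = 0 := by
  have hi := localVF_coordVF_eventuallyEq p i
  have hj := localVF_coordVF_eventuallyEq p j
  rw [mlieBracket_eq_lieBracket_localVF, hi.lieBracket_vectorField_eq hj,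
    VectorField.lieBracket_eq]
  simp only [fderiv_fun_const, Pi.zero_apply, zero_apply, sub_zero]
  rfl

lemma AffineConnection.TorsionFree.christoffel_comm {D : AffineConnection n M} (hD : D.TorsionFree)
    (p : M) (i j : Fin n) : christoffel D p i j = christoffel D p j i := by
  have htorsion := hD (coordVF p i) (coordVF p j) p
  rw [mlieBracket_coordVF, sub_zero, sub_eq_zero] at htorsion
  rw [christoffel, christoffel, htorsion]

lemma covDeriv_mem_exteriorPower (D : AffineConnection n M) {k : ℕ} {X : MVF n M} (hX : IsHom k X)
    (p : M) (i : Fin n) : covDeriv D X p i ∈ ⋀[ℝ]^k (EuclideanSpace ℝ (Fin n)) :=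
  have hx := localRep_mem_exteriorPower hX p
  add_mem (pderiv_mem_exteriorPower hx i _) <| Submodule.sum_mem _ fun j _ =>
    ι_mul_contractLeft_mem_exteriorPower (dx j) (christoffel D p i j) (hx _)

lemma AffineConnection.sgn_smul_induced (D : AffineConnection n M) {k l : ℕ} {X Y : MVF n M}
    (hX : IsHom k X) (hY : IsHom l Y) (p : M) :
    sgn k l • D.induced Y X p = ExteriorAlgebra.map (trivSymm p p)
      (∑ i, covDeriv D X p i * contrL (dx i) (localRep p Y.1 (extChartAt (𝓡 n) p p))) := by
  have hterm (i : Fin n) := sgn_smul_contractRight_mul (dx i)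
    (localRep_mem_exteriorPower hY p (extChartAt (𝓡 n) p p)) (covDeriv_mem_exteriorPower D hX p i)
  simp only [AffineConnection.induced, ← map_smul, Finset.smul_sum, contrR, contrL, hterm]

lemma AffineConnection.induced_sub_sgn_smul_induced (D : AffineConnection n M) {k l : ℕ}
    {X Y : MVF n M} (hX : IsHom k X) (hY : IsHom l Y) (p : M) :
    D.induced X Y p - sgn k l • D.induced Y X p = schouten X Y p +
      ExteriorAlgebra.map (trivSymm p p) (∑ i, ∑ j,
        ExteriorAlgebra.ι ℝ (christoffel D p i j - christoffel D p j i) *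
          contrL (dx i) (localRep p X.1 (extChartAt (𝓡 n) p p)) *
          contrL (dx j) (localRep p Y.1 (extChartAt (𝓡 n) p p))) := by
  have contrR_mul_ι (x) (i : Fin n) (v) : contrR x (dx i) * ExteriorAlgebra.ι ℝ v =
      ExteriorAlgebra.ι ℝ v * contrL (dx i) x :=
    contractRight_mul_ι_eq_ι_mul_contractLeft (dx i) x v
  rw [D.sgn_smul_induced hX hY, AffineConnection.induced, schouten, ← map_sub, ← map_add]
  congr 1
  simp only [covDeriv, mul_add, add_mul, Finset.mul_sum, Finset.sum_mul, ← mul_assoc, contrR_mul_ι,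
    map_sub, sub_mul, Finset.sum_add_distrib, Finset.sum_sub_distrib]
  rw [Finset.sum_comm (f := fun i j => ExteriorAlgebra.ι ℝ (christoffel D p j i) * _ * _)]
  abel

lemma AffineConnection.TorsionFree.induced_sub_sgn_smul_induced {D : AffineConnection n M}
    (hD : D.TorsionFree) {k l : ℕ} {X Y : MVF n M} (hX : IsHom k X) (hY : IsHom l Y) (p : M) :
    D.induced X Y p - sgn k l • D.induced Y X p = schouten X Y p := by
  simp only [D.induced_sub_sgn_smul_induced hX hY, hD.christoffel_comm p, sub_self, map_zero,
    zero_mul, Finset.sum_const_zero, add_zero]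

lemma HigherConnection.torsion_eq_twist_sub_sgn_smul_twist {C : HigherConnection n M}
    (hC : C.underlying.TorsionFree) {k l : ℕ} {X Y : MVF n M} (hX : IsHom k X) (hY : IsHom l Y)
    (p : M) : C.torsion k l X Y p = C.twist X Y p - sgn k l • C.twist Y X p := by
  rw [HigherConnection.torsion, HigherConnection.twist, HigherConnection.twist,
    ← hC.induced_sub_sgn_smul_induced hX hY, smul_sub]
  abel

end InducedConnection

end HigherConn

theorem mainTheorem4 (n : ℕ) (M : Type*) [TopologicalSpace M] [T2Space M]
    [ChartedSpace (EuclideanSpace ℝ (Fin n)) M] [IsManifold (𝓡 n) ∞ M]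
    (C : HigherConn.HigherConnection n M) :
    C.TorsionFree ↔
      C.underlying.TorsionFree ∧
      ∀ (k l : ℕ) (X Y : HigherConn.MVF n M), HigherConn.IsHom k X → HigherConn.IsHom l Y →
        ∀ p, C.twist X Y p = HigherConn.sgn k l • C.twist Y X p := by
  suffices h : C.underlying.TorsionFree → (C.TorsionFree ↔
      ∀ (k l : ℕ) (X Y : HigherConn.MVF n M), HigherConn.IsHom k X → HigherConn.IsHom l Y →
        ∀ p, C.twist X Y p = HigherConn.sgn k l • C.twist Y X p) from
    ⟨fun hC => ⟨hC.underlying, (h hC.underlying).1 hC⟩, fun ⟨hD, htwist⟩ => (h hD).2 htwist⟩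
  intro hD
  refine forall₄_congr fun k l X Y => forall₃_congr fun hX hY p => ?_
  rw [HigherConn.HigherConnection.torsion_eq_twist_sub_sgn_smul_twist hD hX hY, sub_eq_zero]
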